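/- **Notation.** A Young diagram of degree $n\ge 0$ is a multiset $\Delta$ of positive integers (its line lengths) with sum $|\Delta|=n$; put $|\mathrm{Aut}(\Delta)|=\prod_j m_j!\,j^{m_j}$, where $m_j$ is the number of lines of length $j$. Let $A_n$ be the complex vector space with basis the Young diagrams of degree $n$. For Young diagrams $\Delta_1,\dots,\Delta_k$ of degree $n$ let $H(\Delta_1,\dots,\Delta_k)$ be the Hurwitz number of the sphere: the sum of $1/|\mathrm{Aut}|$ over the isomorphism classes of (not necessarily connected) degree $n$ coverings of the sphere, with critical values contained in $k$ marked points and of topological types $\Delta_1,\dots,\Delta_k$ there. Here a covering is given by its monodromy, i.e. by permutations $s_1,\dots,s_k\in S_n$ of cycle types $\Delta_1,\dots,\Delta_k$ with $s_1\cdots s_k=1$; isomorphisms are simultaneous conjugations, and $\mathrm{Aut}$ is the common centralizer. The product $*$ on $A_n$ is the bilinear operation $$\Delta_1*\Delta_2=\sum_{|\Delta_3|=n}|\mathrm{Aut}(\Delta_3)|\,H(\Delta_1,\Delta_2,\Delta_3)\,\Delta_3 ,$$ that is, $(\Delta_1*\Delta_2,\Delta_3)=H(\Delta_1,\Delta_2,\Delta_3)$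 for the form $(\Delta,\Delta')=H(\Delta,\Delta')=\delta_{\Delta,\Delta'}/|\mathrm{Aut}(\Delta)|$. It makes $A_n$ a commutative algebra with unit the diagram $1^n$ all of whose lines have length $1$. Let $A^{as}=\prod_{n\ge1}A_n$ be the algebra of sequences $(a^1,a^2,\dots)$, $a^n\in A_n$, with entrywise operations. For $m\le n$ let $\rho^A_n:A_m\to A_n$ be the linear map $$\rho^A_n(\Delta)=\frac{|\mathrm{Aut}(\tilde\Delta)|}{|\mathrm{Aut}(\Delta)|\,|\mathrm{Aut}(\tilde\Delta\setminus\Delta)|}\,\tilde\Delta ,$$ where $\tilde\Delta$ is $\Delta$ with $n-m$ lines of length $1$ added and $\tilde\Delta\setminus\Delta=1^{n-m}$. For $a\in A_m$ let $a^{as}=(a^1,a^2,\dots)\in A^{as}$, where $a^i=0$ for $i<m$ and $a^i=\rho^A_i(a)$ for $i\ge m$. Let $D_\infty$ be the semigroup of pairs $(d,\sigma)$, where $d$ is a finite set of natural numbers and $\sigma$ is a permutation of $d$, with $(d_1,\sigma_1)(d_2,\sigma_2)=(d_1\cup d_2,\sigma_1\sigma_2)$, permutations being extended by the identity. Every element of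 $D_\infty$ has finitely many factorizations into two elements, so formal, possibly infinite, complex linear combinations of elements of $D_\infty$ form an algebra. For a Young diagram $\Delta$ let $[\Delta]=\sum(d,\sigma)$ be the formal sum over all $(d,\sigma)$ such that $\sigma$ has cycle type $\Delta$ on $d$ (fixed points in $d$ included). The Ivanov–Kerov algebra $A_\infty$ is the linear span of all $[\Delta]$, $|\Delta|\ge0$, which is a subalgebra; its unit is $[\emptyset]$. Identify $\Delta$ with $[\Delta]$, so that each $A_m$ maps linearly to $A_\infty$. **Theorem 3.1.** The correspondence $a\mapsto a^{as}$ ($a\in A_m$, $m\ge0$) extends linearly, in a unique way, to a map $\rho^A_\uparrow:A_\infty\to A^{as}$, and $\rho^A_\uparrow$ is an injective homomorphism of unital $\mathbb{C}$-algebras. (In particular its restriction to the span of the $[\Delta]$ with $|\Delta|\ge1$ is an injective algebra homomorphism.) -/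

import Mathlib

open scoped Nat

noncomputable section

/-- The order of the automorphism group of a Young diagram whose lines have the lengths listed
in `m`: `∏ j, m_j! * j ^ m_j`, where `m_j` is the number of lines of length `j`. -/
def autCard (m : Multiset ℕ) : ℕ := ∏ j ∈ m.toFinset, (m.count j)! * j ^ m.count j

/-- The cycle type of a permutation of `n` points (fixed points included), as a Young diagram of
degree `n`. -/
def permType {n : ℕ} (s : Equiv.Perm (Fin n)) : n.Partition where
  parts := s.partition.parts
  parts_pos := s.partition.parts_pos
  parts_sum := by simpa using s.partition.parts_sum

theorem permType_eq_iff {n : ℕ} (s t : Equiv.Perm (Fin n)) :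
    permType s = permType t ↔ IsConj s t := by
  rw [Equiv.Perm.partition_eq_of_isConj, Nat.Partition.ext_iff, Nat.Partition.ext_iff]
  rfl

theorem permType_conj {n : ℕ} (g s : Equiv.Perm (Fin n)) :
    permType (g * s * g⁻¹) = permType s :=
  (permType_eq_iff _ _).2 (isConj_iff.2 ⟨g⁻¹, by group⟩)

theorem permType_inv {n : ℕ} (s : Equiv.Perm (Fin n)) : permType s⁻¹ = permType s := by
  rw [permType_eq_iff, Equiv.Perm.isConj_iff_cycleType_eq, Equiv.Perm.cycleType_inv]

theorem permType_surjective (n : ℕ) : Function.Surjective (permType (n := n)) := by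
  intro p
  have key : (p.parts.filter fun i => 2 ≤ i) +
      Multiset.replicate (n - (p.parts.filter fun i => 2 ≤ i).sum) 1 = p.parts := by
    have h1 : p.parts.filter (fun i => ¬ 2 ≤ i) =
        Multiset.replicate (p.parts.filter fun i => ¬ 2 ≤ i).card 1 := by
      rw [Multiset.eq_replicate_card]
      intro b hb
      have := p.parts_pos (Multiset.mem_of_mem_filter hb)
      have := Multiset.of_mem_filter hb
      omega
    have h2 := Multiset.filter_add_not (fun i => 2 ≤ i) p.parts
    have h3 : (p.parts.filter fun i => ¬ 2 ≤ i).sum =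
        (p.parts.filter fun i => ¬ 2 ≤ i).card := by
      conv_lhs => rw [h1]
      simp
    have h4 := congrArg Multiset.sum h2
    rw [Multiset.sum_add, p.parts_sum, h3] at h4
    conv_rhs => rw [← h2, h1]
    congr 2
    omega
  obtain ⟨s, hs⟩ := (Equiv.Perm.exists_with_cycleType_iff (Fin n)
      (m := p.parts.filter fun i => 2 ≤ i)).2 ⟨by
        have h2 := congrArg Multiset.sum (Multiset.filter_add_not (fun i => 2 ≤ i) p.parts)
        rw [Multiset.sum_add, p.parts_sum] at h2
        simp only [Fintype.card_fin]
        omega, fun a ha => Multiset.of_mem_filter ha⟩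
  refine ⟨s, Nat.Partition.ext ?_⟩
  change s.partition.parts = _
  rw [Equiv.Perm.parts_partition, ← Equiv.Perm.sum_cycleType, hs, Fintype.card_fin, key]

/-- A covering of the sphere of degree `n` (not necessarily connected) with critical values among
`k` marked points, given by its monodromy: the fibre over a base point is numbered by `Fin n`,
going around the `i`-th marked point permutes the fibre by `s i`, and `s 0 * ⋯ * s (k - 1) = 1`.
The local invariant at the `i`-th marked point (the degrees of the contours over a small circle
around it) is the cycle type of `s i`; it is prescribed to be `α i`.
Isomorphisms of coverings are simultaneous conjugations, so the acting group is the symmetric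
group acting by conjugation. -/
def sphereCoverings {n k : ℕ} (α : Fin k → n.Partition) :
    SubMulAction (ConjAct (Equiv.Perm (Fin n))) (Fin k → Equiv.Perm (Fin n)) where
  carrier := {s | (∀ i, permType (s i) = α i) ∧ (List.ofFn s).prod = 1}
  smul_mem' := by
    rintro g s ⟨h1, h2⟩
    refine ⟨fun i => ?_, ?_⟩
    · rw [Pi.smul_apply, ConjAct.smul_def, permType_conj, h1]
    · have : List.ofFn (g • s) = (List.ofFn s).map (MulDistribMulAction.toMonoidHom _ g) := by
        rw [List.map_ofFn]; rfl
      rw [this, ← map_list_prod, h2, map_one]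

/-- The Hurwitz number of degree `n` of the sphere with `k` marked points: the sum over the
isomorphism classes of coverings with local invariants `α` of `1 / |Aut|`. -/
def hurwitzNumber {n k : ℕ} (α : Fin k → n.Partition) : ℚ :=
  ∑ᶠ c : MulAction.orbitRel.Quotient (ConjAct (Equiv.Perm (Fin n))) (sphereCoverings α),
    1 / (Nat.card (MulAction.stabilizer (ConjAct (Equiv.Perm (Fin n))) c.out) : ℚ)

theorem hurwitzNumber_eq {n k : ℕ} (α : Fin k → n.Partition) :
    hurwitzNumber α = Nat.card (sphereCoverings α) / (n ! : ℚ) := by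
  classical
  have e := MulAction.selfEquivSigmaOrbitsQuotientStabilizer
    (ConjAct (Equiv.Perm (Fin n))) (sphereCoverings α)
  have : Fintype (MulAction.orbitRel.Quotient (ConjAct (Equiv.Perm (Fin n)))
    (sphereCoverings α)) := Fintype.ofFinite _
  rw [hurwitzNumber, finsum_eq_sum_of_fintype, Nat.card_congr e, Nat.card_sigma, Nat.cast_sum,
    Finset.sum_div]
  refine Finset.sum_congr rfl fun c _ => ?_
  have h := Subgroup.card_eq_card_quotient_mul_card_subgroup
    (MulAction.stabilizer (ConjAct (Equiv.Perm (Fin n))) c.out)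
  have h0 : Nat.card (ConjAct (Equiv.Perm (Fin n))) = n ! := by
    have : Nat.card (Equiv.Perm (Fin n)) = n ! := by
      rw [Nat.card_eq_fintype_card, Fintype.card_perm, Fintype.card_fin]
    exact this
  rw [h0] at h
  have hs : (Nat.card (MulAction.stabilizer (ConjAct (Equiv.Perm (Fin n))) c.out) : ℚ) ≠ 0 :=
    Nat.cast_ne_zero.2 Nat.card_pos.ne'
  have hn : (n ! : ℚ) ≠ 0 := Nat.cast_ne_zero.2 (Nat.factorial_ne_zero n)
  rw [div_eq_div_iff hs hn, one_mul, h]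
  push_cast
  rfl

theorem card_permType_mul {n : ℕ} (p : n.Partition) :
    Nat.card {s : Equiv.Perm (Fin n) // permType s = p} * autCard p.parts = n ! := by
  obtain ⟨g, rfl⟩ := permType_surjective n p
  have h := Equiv.Perm.card_isConj_mul_eq g
  rw [Fintype.card_fin] at h
  have h1 : Nat.card {s : Equiv.Perm (Fin n) // permType s = permType g} =
      Nat.card {h : Equiv.Perm (Fin n) | IsConj g h} := by
    refine Nat.card_congr (Equiv.subtypeEquivRight fun s => ?_)
    rw [permType_eq_iff, isConj_comm]; rfl
  have h2 : autCard (permType g).parts = (n - g.cycleType.sum)! * g.cycleType.prod *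
      (∏ n ∈ g.cycleType.toFinset, (g.cycleType.count n)!) := by
    change autCard g.partition.parts = _
    rw [Equiv.Perm.parts_partition, ← Equiv.Perm.sum_cycleType, Fintype.card_fin]
    generalize hk : n - g.cycleType.sum = k
    have hc1 : 1 ∉ g.cycleType := fun h => by
      have := Equiv.Perm.two_le_of_mem_cycleType h; omega
    have hc0 : g.cycleType.count 1 = 0 := Multiset.count_eq_zero.2 hc1
    have hrest : ∀ j ∈ g.cycleType.toFinset,
        (g.cycleType + Multiset.replicate k 1).count j = g.cycleType.count j := by
      intro j hj
      rw [Multiset.count_add, Multiset.count_replicate, if_neg, add_zero]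
      rintro rfl
      exact hc1 (Multiset.mem_toFinset.1 hj)
    have hsub : (g.cycleType + Multiset.replicate k 1).toFinset ⊆ insert 1 g.cycleType.toFinset := by
      intro j hj
      rw [Multiset.mem_toFinset, Multiset.mem_add] at hj
      rw [Finset.mem_insert, Multiset.mem_toFinset]
      rcases hj with hj | hj
      · exact Or.inr hj
      · exact Or.inl (Multiset.eq_of_mem_replicate hj)
    rw [autCard, Finset.prod_subset hsub, Finset.prod_insert (by simpa using hc1),
      Finset.prod_congr rfl (fun j hj => by rw [hrest j hj]), Finset.prod_mul_distrib,
      ← Finset.prod_multiset_count]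
    · rw [Multiset.count_add, hc0, Multiset.count_replicate_self]
      simp only [zero_add, one_pow, mul_one]
      ring
    · intro j _ hj
      rw [Multiset.mem_toFinset] at hj
      rw [Multiset.count_eq_zero.2 hj]
      simp
  rw [h1, h2, ← h]

/-- The space `A_n` with basis the Young diagrams of degree `n`. -/
def YoungAlgebra (n : ℕ) : Type := n.Partition → ℂ

namespace YoungAlgebra

variable {n : ℕ}

instance : AddCommGroup (YoungAlgebra n) := inferInstanceAs (AddCommGroup (n.Partition → ℂ))
instance : Module ℂ (YoungAlgebra n) := inferInstanceAs (Module ℂ (n.Partition → ℂ))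

@[ext] theorem ext {a b : YoungAlgebra n} (h : ∀ p, a p = b p) : a = b := funext h

/-- A Young diagram as a basis element of `A_n`. -/
def diagram (p : n.Partition) : YoungAlgebra n := fun q => if q = p then 1 else 0

/-- The bilinear form on `A_n` given on Young diagrams by the two-point Hurwitz numbers of the
sphere. -/
def form (a b : YoungAlgebra n) : ℂ :=
  ∑ p : n.Partition, ∑ q : n.Partition, a p * b q * (hurwitzNumber ![p, q] : ℂ)

/-- The product `*` of `A_n`: on Young diagrams
`Δ₁ * Δ₂ = ∑ Δ₃, |Aut Δ₃| H(S, {Δ₁, Δ₂, Δ₃}) Δ₃`, extended bilinearly. -/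
instance : Mul (YoungAlgebra n) where
  mul a b := fun r => ∑ p : n.Partition, ∑ q : n.Partition,
    a p * b q * (autCard r.parts * (hurwitzNumber ![p, q, r] : ℂ))

/-- The unit of `A_n`: the Young diagram with all lines of unit length. -/
instance : One (YoungAlgebra n) where
  one := diagram (permType 1)

theorem add_apply (a b : YoungAlgebra n) (p : n.Partition) : (a + b) p = a p + b p := rfl
theorem zero_apply (p : n.Partition) : (0 : YoungAlgebra n) p = 0 := rfl
theorem smul_apply (c : ℂ) (a : YoungAlgebra n) (p : n.Partition) : (c • a) p = c * a p := rfl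

theorem mul_apply (a b : YoungAlgebra n) (r : n.Partition) :
    (a * b) r = ∑ p : n.Partition, ∑ q : n.Partition,
      a p * b q * (autCard r.parts * (hurwitzNumber ![p, q, r] : ℂ)) := rfl

theorem autCard_ne_zero (p : n.Partition) : (autCard p.parts : ℂ) ≠ 0 := by
  have h := card_permType_mul p
  intro h0
  rw [Nat.cast_eq_zero] at h0
  rw [h0, mul_zero] at h
  exact Nat.factorial_ne_zero n h.symm

theorem hurwitzNumber_two (p q : n.Partition) :
    (hurwitzNumber ![p, q] : ℂ) = if p = q then 1 / (autCard p.parts : ℂ) else 0 := by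
  have hp := card_permType_mul p
  have hn : (n ! : ℂ) ≠ 0 := Nat.cast_ne_zero.2 (Nat.factorial_ne_zero n)
  have hinv : ∀ u : sphereCoverings ![p, q], u.1 1 = (u.1 0)⁻¹ := by
    intro u
    have h := u.2.2
    simp only [List.ofFn_succ, List.ofFn_zero, List.prod_cons, List.prod_nil, mul_one] at h
    exact eq_inv_of_mul_eq_one_right h
  rw [hurwitzNumber_eq]
  split_ifs with h
  · subst h
    have e : sphereCoverings ![p, p] ≃ {s : Equiv.Perm (Fin n) // permType s = p} :=
      { toFun := fun u => ⟨u.1 0, u.2.1 0⟩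
        invFun := fun s => ⟨![s.1, s.1⁻¹], by
          refine ⟨fun i => ?_, ?_⟩
          · fin_cases i
            · exact s.2
            · exact (permType_inv _).trans s.2
          · simp [List.ofFn_succ]⟩
        left_inv := fun u => by
          apply Subtype.ext
          funext i
          fin_cases i
          · rfl
          · exact (hinv u).symm
        right_inv := fun s => rfl }
    rw [Nat.card_congr e]
    push_cast
    rw [div_eq_div_iff hn (autCard_ne_zero p), one_mul]
    exact_mod_cast hp
  · have : IsEmpty (sphereCoverings ![p, q]) := by
      refine ⟨fun u => h ?_⟩
      have h0 : permType (u.1 0) = p := u.2.1 0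
      have h1 : permType (u.1 1) = q := u.2.1 1
      exact h0.symm.trans (((congrArg permType (hinv u)).trans (permType_inv _)).symm.trans h1)
    simp

/-- The defining property of the product: its matrix elements with respect to the form are the
three-point Hurwitz numbers. -/
theorem form_mul_diagram (p q r : n.Partition) :
    form (diagram p * diagram q) (diagram r) = (hurwitzNumber ![p, q, r] : ℂ) := by
  simp only [form, mul_apply, diagram, ite_mul, one_mul, zero_mul, mul_ite, mul_one, mul_zero,
    Finset.sum_ite_eq', Finset.mem_univ, if_true, hurwitzNumber_two]
  simp only [Finset.sum_ite_eq, Finset.sum_ite_eq', Finset.mem_univ, if_true]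
  rw [mul_one_div, mul_div_cancel_left₀ _ (autCard_ne_zero r)]

theorem card_conj_invariant (p q : n.Partition) {s t : Equiv.Perm (Fin n)}
    (h : permType s = permType t) :
    Nat.card {x : Equiv.Perm (Fin n) // permType x = p ∧ permType (x⁻¹ * s) = q} =
      Nat.card {x : Equiv.Perm (Fin n) // permType x = p ∧ permType (x⁻¹ * t) = q} := by
  obtain ⟨g, rfl⟩ := isConj_iff.1 ((permType_eq_iff s t).1 h)
  refine Nat.card_congr ((MulAut.conj g).toEquiv.subtypeEquiv fun x => ?_)
  have : (MulAut.conj g x)⁻¹ * (g * s * g⁻¹) = g * (x⁻¹ * s) * g⁻¹ := by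
    rw [MulAut.conj_apply]; group
  change _ ↔ permType (MulAut.conj g x) = p ∧ permType ((MulAut.conj g x)⁻¹ * (g * s * g⁻¹)) = q
  rw [this, permType_conj, MulAut.conj_apply, permType_conj]

theorem structure_constant (p q : n.Partition) (s : Equiv.Perm (Fin n)) :
    (autCard (permType s).parts * (hurwitzNumber ![p, q, permType s] : ℂ)) =
      Nat.card {x : Equiv.Perm (Fin n) // permType x = p ∧ permType (x⁻¹ * s) = q} := by
  classical
  have e : sphereCoverings ![p, q, permType s] ≃
      Σ w : {w : Equiv.Perm (Fin n) // permType w = permType s},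
        {x : Equiv.Perm (Fin n) // permType x = p ∧ permType (x⁻¹ * w.1⁻¹) = q} :=
    { toFun := fun u => ⟨⟨u.1 2, u.2.1 2⟩, ⟨u.1 0, u.2.1 0, by
        have h := u.2.2
        have h1 := u.2.1 1
        simp only [List.ofFn_succ, List.ofFn_zero, List.prod_cons, List.prod_nil, mul_one] at h
        change u.1 0 * (u.1 1 * u.1 2) = 1 at h
        have : (u.1 0)⁻¹ * (u.1 2)⁻¹ = u.1 1 := by
          rw [← mul_assoc] at h
          rw [← eq_inv_of_mul_eq_one_left h]; group
        rw [this]; exact h1⟩⟩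
      invFun := fun v => ⟨![v.2.1, v.2.1⁻¹ * v.1.1⁻¹, v.1.1], by
        refine ⟨fun i => ?_, ?_⟩
        · fin_cases i
          · exact v.2.2.1
          · exact v.2.2.2
          · exact v.1.2
        · simp [List.ofFn_succ]⟩
      left_inv := fun u => by
        have h := u.2.2
        simp only [List.ofFn_succ, List.ofFn_zero, List.prod_cons, List.prod_nil, mul_one] at h
        change u.1 0 * (u.1 1 * u.1 2) = 1 at h
        have : (u.1 0)⁻¹ * (u.1 2)⁻¹ = u.1 1 := by
          rw [← mul_assoc] at h
          rw [← eq_inv_of_mul_eq_one_left h]; group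
        apply Subtype.ext
        funext i
        fin_cases i
        · rfl
        · exact this
        · rfl
      right_inv := fun v => rfl }
  have hc : Nat.card (sphereCoverings ![p, q, permType s]) =
      Nat.card {w : Equiv.Perm (Fin n) // permType w = permType s} *
        Nat.card {x : Equiv.Perm (Fin n) // permType x = p ∧ permType (x⁻¹ * s) = q} := by
    rw [Nat.card_congr e, Nat.card_sigma,
      Finset.sum_congr rfl (fun (w : {w : Equiv.Perm (Fin n) // permType w = permType s}) _ =>
        card_conj_invariant p q (s := w.1⁻¹) (t := s) ((permType_inv _).trans w.2))]
    simp
  have hz := card_permType_mul (permType s)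
  have hn : (n ! : ℂ) ≠ 0 := Nat.cast_ne_zero.2 (Nat.factorial_ne_zero n)
  rw [hurwitzNumber_eq, hc]
  push_cast
  rw [mul_div_assoc', div_eq_iff hn, ← hz]
  push_cast
  ring

/-- In terms of class functions the product is the convolution on the symmetric group. -/
theorem mul_permType (a b : YoungAlgebra n) (s : Equiv.Perm (Fin n)) :
    (a * b) (permType s) = ∑ x : Equiv.Perm (Fin n), a (permType x) * b (permType (x⁻¹ * s)) := by
  classical
  rw [mul_apply]
  have h : ∀ x : Equiv.Perm (Fin n), a (permType x) * b (permType (x⁻¹ * s)) =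
      ∑ p : n.Partition, ∑ q : n.Partition,
        if permType x = p ∧ permType (x⁻¹ * s) = q then a p * b q else 0 := by
    intro x
    simp [ite_and]
  rw [Fintype.sum_congr _ _ h]
  conv_rhs => rw [Finset.sum_comm]
  refine Fintype.sum_congr _ _ fun p => ?_
  conv_rhs => rw [Finset.sum_comm]
  refine Fintype.sum_congr _ _ fun q => ?_
  rw [structure_constant, ← Finset.sum_filter, Finset.sum_const, nsmul_eq_mul,
    Nat.card_eq_fintype_card, Fintype.card_subtype, mul_comm]

theorem ext_permType {a b : YoungAlgebra n} (h : ∀ s, a (permType s) = b (permType s)) :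
    a = b := by
  ext p
  obtain ⟨s, rfl⟩ := permType_surjective n p
  exact h s

theorem one_permType (s : Equiv.Perm (Fin n)) :
    (1 : YoungAlgebra n) (permType s) = if s = 1 then 1 else 0 := by
  change (if permType s = permType 1 then (1 : ℂ) else 0) = _
  have : permType s = permType 1 ↔ s = 1 := by
    rw [permType_eq_iff, isConj_comm, isConj_one_right]
  simp only [this]

theorem mul_comm_aux (a b : YoungAlgebra n) : a * b = b * a := by
  refine ext_permType fun s => ?_
  rw [mul_permType, mul_permType]
  refine Fintype.sum_equiv ((Equiv.inv _).trans (Equiv.mulRight s)) _ _ fun x => ?_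
  change _ = b (permType (x⁻¹ * s)) * a (permType ((x⁻¹ * s)⁻¹ * s))
  have : (x⁻¹ * s)⁻¹ * s = s⁻¹ * x * s⁻¹⁻¹ := by group
  rw [this, permType_conj, mul_comm]

theorem one_mul_aux (a : YoungAlgebra n) : 1 * a = a := by
  refine ext_permType fun s => ?_
  rw [mul_permType]
  simp [one_permType]

theorem mul_assoc_aux (a b c : YoungAlgebra n) : a * b * c = a * (b * c) := by
  refine ext_permType fun s => ?_
  simp only [mul_permType, Finset.sum_mul, Finset.mul_sum]
  rw [Finset.sum_comm]
  refine Finset.sum_congr rfl fun y _ => ?_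
  refine Fintype.sum_equiv (Equiv.mulLeft y⁻¹) _ _ fun x => ?_
  simp [mul_assoc]

instance : CommRing (YoungAlgebra n) where
  __ := (inferInstance : AddCommGroup (YoungAlgebra n))
  mul_comm := mul_comm_aux
  one_mul := one_mul_aux
  mul_one a := by rw [mul_comm_aux, one_mul_aux]
  mul_assoc := mul_assoc_aux
  left_distrib a b c := by
    refine ext_permType fun s => ?_
    simp only [add_apply, mul_permType, mul_add, Finset.sum_add_distrib]
  right_distrib a b c := by
    refine ext_permType fun s => ?_
    simp only [add_apply, mul_permType, add_mul, Finset.sum_add_distrib]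
  zero_mul a := by
    refine ext_permType fun s => ?_
    simp [zero_apply, mul_permType]
  mul_zero a := by
    refine ext_permType fun s => ?_
    simp [zero_apply, mul_permType]

instance : Algebra ℂ (YoungAlgebra n) := Algebra.ofModule
  (fun c a b => by
    refine ext_permType fun s => ?_
    simp only [smul_apply, mul_permType, Finset.mul_sum, mul_assoc])
  (fun c a b => by
    refine ext_permType fun s => ?_
    simp only [smul_apply, mul_permType, Finset.mul_sum, mul_left_comm])

end YoungAlgebra

/-- An element of the semigroup `D_∞`: a finite set `dom` of natural numbers with a permutation of
it, stored as the permutation `perm` of all natural numbers that fixes everything outside `dom`. -/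
@[ext] structure PartialPerm where
  dom : Finset ℕ
  perm : Equiv.Perm ℕ
  perm_eq : ∀ x ∉ dom, perm x = x

namespace PartialPerm

instance : Mul PartialPerm where
  mul p q := ⟨p.dom ∪ q.dom, p.perm * q.perm, fun x hx => by
    rw [Finset.mem_union, not_or] at hx
    rw [Equiv.Perm.mul_apply, q.perm_eq x hx.2, p.perm_eq x hx.1]⟩

instance : One PartialPerm where
  one := ⟨∅, 1, fun _ _ => rfl⟩

instance : Monoid PartialPerm where
  mul_assoc p q r := PartialPerm.ext (Finset.union_assoc _ _ _) (mul_assoc _ _ _)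
  one_mul p := PartialPerm.ext (Finset.empty_union _) (one_mul _)
  mul_one p := PartialPerm.ext (Finset.union_empty _) (mul_one _)

theorem perm_mem_iff (p : PartialPerm) (x : ℕ) : p.perm x ∈ p.dom ↔ x ∈ p.dom := by
  constructor
  · intro h
    by_contra hx
    rw [p.perm_eq x hx] at h
    exact hx h
  · intro h
    by_contra hx
    have := p.perm.injective (p.perm_eq _ hx)
    rw [this] at hx
    exact hx h

/-- The permutation of the set `dom`. -/
def restrict (p : PartialPerm) : Equiv.Perm p.dom := p.perm.subtypePerm p.perm_mem_iff

/-- The Young diagram `[d, σ]` of degree `|d|`, as the multiset of its line lengths: the cycle type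
of `σ` on `d`, fixed points included. -/
def type (p : PartialPerm) : Multiset ℕ := p.restrict.partition.parts

theorem type_sum (p : PartialPerm) : p.type.sum = p.dom.card := by
  rw [type, p.restrict.partition.parts_sum, Fintype.card_coe]

/-- The action of a permutation of the natural numbers by conjugation. -/
def conj (g : Equiv.Perm ℕ) (p : PartialPerm) : PartialPerm where
  dom := p.dom.map g.toEmbedding
  perm := g * p.perm * g⁻¹
  perm_eq x hx := by
    have : g⁻¹ x ∉ p.dom := fun h => hx (Finset.mem_map.2 ⟨g⁻¹ x, h, by simp⟩)
    rw [Equiv.Perm.mul_apply, Equiv.Perm.mul_apply, p.perm_eq _ this]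
    exact g.apply_symm_apply x

theorem conj_mul (g : Equiv.Perm ℕ) (p q : PartialPerm) :
    conj g (p * q) = conj g p * conj g q := by
  refine PartialPerm.ext (Finset.map_union _ _) ?_
  change g * (p.perm * q.perm) * g⁻¹ = (g * p.perm * g⁻¹) * (g * q.perm * g⁻¹)
  group

theorem conj_conj_inv (g : Equiv.Perm ℕ) (p : PartialPerm) : conj g (conj g⁻¹ p) = p := by
  refine PartialPerm.ext ?_ ?_
  · change (p.dom.map g⁻¹.toEmbedding).map g.toEmbedding = p.dom
    ext x
    simp only [Finset.mem_map, Equiv.coe_toEmbedding]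
    constructor
    · rintro ⟨_, ⟨y, hy, rfl⟩, rfl⟩
      rwa [show g (g⁻¹ y) = y from g.apply_symm_apply y]
    · exact fun hx => ⟨_, ⟨x, hx, rfl⟩, g.apply_symm_apply x⟩
  · change g * (g⁻¹ * p.perm * g⁻¹⁻¹) * g⁻¹ = p.perm
    group

theorem cycleType_permCongr {α β : Type} [Fintype α] [DecidableEq α] [Fintype β]
    [DecidableEq β] (e : α ≃ β) (s : Equiv.Perm α) :
    (e.permCongr s).cycleType = s.cycleType := by
  rw [← Equiv.Perm.cycleType_extendDomain
    (e.trans (Equiv.subtypeUnivEquiv (p := fun _ : β => True) fun _ => trivial).symm) (g := s)]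
  congr 1

theorem type_eq_of_equiv {p q : PartialPerm} (e : p.dom ≃ q.dom)
    (he : e.permCongr p.restrict = q.restrict) : p.type = q.type := by
  have h1 : p.restrict.cycleType = q.restrict.cycleType := by
    rw [← he, cycleType_permCongr]
  have h2 : Fintype.card p.dom = Fintype.card q.dom := Fintype.card_congr e
  rw [type, type, Equiv.Perm.parts_partition, Equiv.Perm.parts_partition,
    ← Equiv.Perm.sum_cycleType, ← Equiv.Perm.sum_cycleType, h1, h2]

theorem type_conj (g : Equiv.Perm ℕ) (p : PartialPerm) : (conj g p).type = p.type := by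
  symm
  refine type_eq_of_equiv (g.subtypeEquiv fun x => ?_) ?_
  · simp [conj]
  · ext x
    rfl

theorem exists_conj {p q : PartialPerm} (h : p.type = q.type) : ∃ g, conj g p = q := by
  have hcard : Fintype.card p.dom = Fintype.card q.dom := by
    rw [Fintype.card_coe, Fintype.card_coe, ← type_sum, ← type_sum, h]
  let e₀ : p.dom ≃ q.dom := Fintype.equivOfCardEq hcard
  have h1 : (e₀.permCongr p.restrict).cycleType = q.restrict.cycleType := by
    rw [← Equiv.Perm.filter_parts_partition_eq_cycleType (σ := q.restrict)]
    change _ = q.type.filter _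
    rw [← h]
    change _ = p.restrict.partition.parts.filter _
    rw [Equiv.Perm.filter_parts_partition_eq_cycleType, cycleType_permCongr]
  obtain ⟨c, hc⟩ := isConj_iff.1 (Equiv.Perm.isConj_iff_cycleType_eq.2 h1)
  let e : p.dom ≃ q.dom := e₀.trans c
  have he : ∀ x, e (p.restrict x) = q.restrict (e x) := by
    intro x
    rw [← hc]
    simp [e]
  have hinf : ∀ s : Finset ℕ, Infinite {x // ¬ x ∈ s} := fun s =>
    Set.infinite_coe_iff.2 (s.finite_toSet.infinite_compl)
  have := hinf p.dom
  have := hinf q.dom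
  have : Nonempty ({x // ¬ x ∈ p.dom} ≃ {x // ¬ x ∈ q.dom}) := nonempty_equiv_of_countable
  obtain ⟨e'⟩ := this
  let g : Equiv.Perm ℕ := ((Equiv.sumCompl (fun x => x ∈ p.dom)).symm.trans
    (Equiv.sumCongr e e')).trans (Equiv.sumCompl (fun x => x ∈ q.dom))
  have hg1 : ∀ x (hx : x ∈ p.dom), g x = e ⟨x, hx⟩ := by
    intro x hx
    simp [g, Equiv.sumCompl_symm_apply_of_pos hx]
  have hg2 : ∀ x (hx : x ∉ p.dom), g x ∉ q.dom := by
    intro x hx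
    simp only [g, Equiv.trans_apply]
    rw [Equiv.sumCompl_symm_apply_of_neg hx]
    exact (e' ⟨x, hx⟩).2
  refine ⟨g, PartialPerm.ext ?_ ?_⟩
  · ext y
    change y ∈ p.dom.map _ ↔ _
    rw [Finset.mem_map]
    constructor
    · rintro ⟨x, hx, rfl⟩
      change g x ∈ _
      rw [hg1 x hx]
      exact (e _).2
    · intro hy
      refine ⟨g.symm y, ?_, g.apply_symm_apply y⟩
      by_contra hx
      exact hg2 _ hx (by rwa [g.apply_symm_apply])
  · change g * p.perm * g⁻¹ = q.perm
    rw [mul_inv_eq_iff_eq_mul]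
    ext x
    rw [Equiv.Perm.mul_apply, Equiv.Perm.mul_apply]
    by_cases hx : x ∈ p.dom
    · have h3 := he ⟨x, hx⟩
      have h4 : p.restrict ⟨x, hx⟩ = ⟨p.perm x, (p.perm_mem_iff x).2 hx⟩ := rfl
      rw [hg1 x hx, hg1 _ ((p.perm_mem_iff x).2 hx), ← h4, h3]
      rfl
    · rw [p.perm_eq x hx, q.perm_eq _ (hg2 x hx)]

theorem finite_dom_subset (s : Finset ℕ) : {p : PartialPerm | p.dom ⊆ s}.Finite := by
  have hmem : ∀ p : {p : PartialPerm | p.dom ⊆ s}, ∀ x, p.1.perm x ∈ s ↔ x ∈ s := by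
    intro p x
    by_cases hx : x ∈ p.1.dom
    · exact ⟨fun _ => p.2 hx, fun _ => p.2 ((p.1.perm_mem_iff x).2 hx)⟩
    · rw [p.1.perm_eq x hx]
  refine Set.finite_coe_iff.1 (Finite.of_injective
    (β := s.powerset × Equiv.Perm s)
    (fun p => (⟨p.1.dom, Finset.mem_powerset.2 p.2⟩, p.1.perm.subtypePerm (hmem p))) ?_)
  intro p q h
  rw [Prod.mk.injEq] at h
  have h1 : p.1.dom = q.1.dom := congrArg Subtype.val h.1
  refine Subtype.ext (PartialPerm.ext h1 (Equiv.ext fun x => ?_))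
  by_cases hx : x ∈ s
  · exact congrArg Subtype.val (Equiv.congr_fun h.2 ⟨x, hx⟩)
  · rw [p.1.perm_eq x fun h => hx (p.2 h), q.1.perm_eq x fun h => hx (q.2 h)]

theorem finite_factorizations (p : PartialPerm) :
    {u : PartialPerm × PartialPerm | u.1 * u.2 = p}.Finite := by
  refine ((finite_dom_subset p.dom).prod (finite_dom_subset p.dom)).subset ?_
  rintro u rfl
  exact ⟨Finset.subset_union_left, Finset.subset_union_right⟩

/-- The finitely many ways to write a partial permutation as a product of two. -/
def factorizations (p : PartialPerm) : Finset (PartialPerm × PartialPerm) :=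
  p.finite_factorizations.toFinset

theorem mem_factorizations {p : PartialPerm} {u : PartialPerm × PartialPerm} :
    u ∈ p.factorizations ↔ u.1 * u.2 = p := by
  simp [factorizations]

end PartialPerm

/-- The completed semigroup algebra of `D_∞`: formal, possibly infinite, sums
`∑ p, f p • p` of elements of `D_∞` with complex coefficients. -/
def FormalSum : Type := PartialPerm → ℂ

namespace FormalSum

open PartialPerm

instance : AddCommGroup FormalSum := inferInstanceAs (AddCommGroup (PartialPerm → ℂ))
instance : Module ℂ FormalSum := inferInstanceAs (Module ℂ (PartialPerm → ℂ))

@[ext] theorem ext {f g : FormalSum} (h : ∀ p, f p = g p) : f = g := funext h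

/-- The product of formal sums, which extends the product of `D_∞` bilinearly. -/
instance : Mul FormalSum where
  mul f g := fun p => ∑ u ∈ p.factorizations, f u.1 * g u.2

open Classical in
instance : One FormalSum where
  one := fun p => if p = 1 then 1 else 0

theorem mul_apply (f g : FormalSum) (p : PartialPerm) :
    (f * g) p = ∑ u ∈ p.factorizations, f u.1 * g u.2 := rfl
open Classical in
theorem one_apply (p : PartialPerm) : (1 : FormalSum) p = if p = 1 then 1 else 0 := rfl
theorem add_apply (f g : FormalSum) (p : PartialPerm) : (f + g) p = f p + g p := rfl
theorem zero_apply (p : PartialPerm) : (0 : FormalSum) p = 0 := rfl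
theorem smul_apply (c : ℂ) (f : FormalSum) (p : PartialPerm) : (c • f) p = c * f p := rfl

theorem mul_assoc_aux (f g h : FormalSum) : f * g * h = f * (g * h) := by
  ext p
  simp only [mul_apply, Finset.sum_mul, Finset.mul_sum]
  rw [Finset.sum_sigma', Finset.sum_sigma']
  refine Finset.sum_nbij'
    (fun w => (⟨(w.2.1, w.2.2 * w.1.2), (w.2.2, w.1.2)⟩ :
      Σ _ : PartialPerm × PartialPerm, PartialPerm × PartialPerm))
    (fun w => (⟨(w.1.1 * w.2.1, w.2.2), (w.1.1, w.2.1)⟩ :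
      Σ _ : PartialPerm × PartialPerm, PartialPerm × PartialPerm)) ?_ ?_ ?_ ?_ ?_
  · rintro ⟨⟨x, c⟩, ⟨a, b⟩⟩ hw
    simp only [Finset.mem_sigma, mem_factorizations] at hw ⊢
    exact ⟨by rw [← mul_assoc, hw.2, hw.1], trivial⟩
  · rintro ⟨⟨a, y⟩, ⟨b, c⟩⟩ hw
    simp only [Finset.mem_sigma, mem_factorizations] at hw ⊢
    exact ⟨by rw [mul_assoc, hw.2, hw.1], trivial⟩
  · rintro ⟨⟨x, c⟩, ⟨a, b⟩⟩ hw
    simp only [Finset.mem_sigma, mem_factorizations] at hw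
    simp [hw.2]
  · rintro ⟨⟨a, y⟩, ⟨b, c⟩⟩ hw
    simp only [Finset.mem_sigma, mem_factorizations] at hw
    simp [hw.2]
  · rintro ⟨⟨x, c⟩, ⟨a, b⟩⟩ _
    exact mul_assoc _ _ _

theorem one_mul_aux (f : FormalSum) : 1 * f = f := by
  ext p
  rw [mul_apply, Finset.sum_eq_single (1, p)]
  · simp [one_apply]
  · rintro ⟨a, b⟩ hu hne
    rw [mem_factorizations] at hu
    rw [one_apply, if_neg, zero_mul]
    rintro rfl
    exact hne (by rw [← hu, one_mul])
  · intro h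
    exact absurd (mem_factorizations.2 (one_mul p)) h

theorem mul_one_aux (f : FormalSum) : f * 1 = f := by
  ext p
  rw [mul_apply, Finset.sum_eq_single (p, 1)]
  · simp [one_apply]
  · rintro ⟨a, b⟩ hu hne
    rw [mem_factorizations] at hu
    rw [one_apply, if_neg, mul_zero]
    rintro rfl
    exact hne (by rw [← hu, mul_one])
  · intro h
    exact absurd (mem_factorizations.2 (mul_one p)) h

instance : Ring FormalSum where
  __ := (inferInstance : AddCommGroup FormalSum)
  one_mul := one_mul_aux
  mul_one := mul_one_aux
  mul_assoc := mul_assoc_aux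
  left_distrib f g h := by
    ext p
    simp only [add_apply, mul_apply, mul_add, Finset.sum_add_distrib]
  right_distrib f g h := by
    ext p
    simp only [add_apply, mul_apply, add_mul, Finset.sum_add_distrib]
  zero_mul f := by
    ext p
    simp [zero_apply, mul_apply]
  mul_zero f := by
    ext p
    simp [zero_apply, mul_apply]

instance : Algebra ℂ FormalSum := Algebra.ofModule
  (fun c f g => by
    ext p
    simp only [smul_apply, mul_apply, Finset.mul_sum, mul_assoc])
  (fun c f g => by
    ext p
    simp only [smul_apply, mul_apply, Finset.mul_sum, mul_left_comm])

/-- The sum `∑ (d, σ)` over all elements of `D_∞` with `[d, σ] = Δ`. -/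
def classSum {n : ℕ} (Δ : n.Partition) : FormalSum := fun p => if p.type = Δ.parts then 1 else 0

/-- The linear span of the class sums of all Young diagrams. -/
def classSpan : Submodule ℂ FormalSum :=
  Submodule.span ℂ (Set.range fun Δ : Σ n, Nat.Partition n => classSum Δ.2)

theorem classSum_mem {n : ℕ} (Δ : n.Partition) : classSum Δ ∈ classSpan :=
  Submodule.subset_span ⟨⟨n, Δ⟩, rfl⟩

/-- The span of the class sums consists of the conjugation invariant formal sums of bounded
degree. -/
theorem mem_classSpan_iff (f : FormalSum) : f ∈ classSpan ↔
    (∃ N, ∀ p : PartialPerm, N < p.dom.card → f p = 0) ∧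
      ∀ p q : PartialPerm, p.type = q.type → f p = f q := by
  constructor
  · intro hf
    refine Submodule.span_induction ?_ ?_ ?_ ?_ hf
    · rintro _ ⟨⟨n, Δ⟩, rfl⟩
      refine ⟨⟨n, fun p hp => if_neg fun h => ?_⟩, fun p q h => ?_⟩
      · have := p.type_sum
        rw [h, Δ.parts_sum] at this
        omega
      · simp only [classSum, h]
    · exact ⟨⟨0, fun _ _ => rfl⟩, fun _ _ _ => rfl⟩
    · rintro f g _ _ ⟨⟨N, hN⟩, hf⟩ ⟨⟨M, hM⟩, hg⟩
      refine ⟨⟨max N M, fun p hp => ?_⟩, fun p q h => ?_⟩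
      · rw [add_apply, hN p (lt_of_le_of_lt (le_max_left _ _) hp),
          hM p (lt_of_le_of_lt (le_max_right _ _) hp), add_zero]
      · rw [add_apply, add_apply, hf p q h, hg p q h]
    · rintro c f _ ⟨⟨N, hN⟩, hf⟩
      refine ⟨⟨N, fun p hp => ?_⟩, fun p q h => ?_⟩
      · rw [smul_apply, hN p hp, mul_zero]
      · rw [smul_apply, smul_apply, hf p q h]
  · rintro ⟨⟨N, hN⟩, hf⟩
    obtain ⟨F, hF⟩ : ∃ F : Multiset ℕ → ℂ, ∀ p : PartialPerm, F p.type = f p :=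
      ⟨Function.extend (β := Multiset ℕ) (γ := ℂ) type (fun p => f p) 0, fun p =>
        Function.FactorsThrough.extend_apply (fun a b h => hf a b h) 0 p⟩
    have key : f = ∑ k ∈ Finset.range (N + 1), ∑ Δ : Nat.Partition k,
        F Δ.parts • classSum Δ := by
      ext p
      have hs : (∑ k ∈ Finset.range (N + 1), ∑ Δ : Nat.Partition k,
          F Δ.parts • classSum Δ) p =
          ∑ k ∈ Finset.range (N + 1), ∑ Δ : Nat.Partition k,
            if p.type = Δ.parts then F Δ.parts else 0 := by
        have hev : ∃ ev : FormalSum →+ ℂ, ∀ f, ev f = f p := ⟨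
          { toFun := fun f => f p, map_zero' := rfl, map_add' := fun _ _ => rfl }, fun _ => rfl⟩
        obtain ⟨ev, hev⟩ := hev
        refine (hev _).symm.trans ?_
        rw [map_sum]
        refine Finset.sum_congr rfl fun k _ => ?_
        rw [map_sum]
        refine Finset.sum_congr rfl fun Δ _ => ?_
        rw [hev, smul_apply, classSum, mul_ite, mul_one, mul_zero]
      rw [hs]
      by_cases hp : N < p.dom.card
      · rw [hN p hp]
        refine (Finset.sum_eq_zero fun k hk => Finset.sum_eq_zero fun Δ _ => if_neg fun h => ?_).symm
        have := p.type_sum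
        rw [h, Δ.parts_sum] at this
        rw [Finset.mem_range] at hk
        omega
      · let Δ₀ : Nat.Partition p.dom.card :=
          ⟨p.type, p.restrict.partition.parts_pos, p.type_sum⟩
        rw [Finset.sum_eq_single p.dom.card, Finset.sum_eq_single Δ₀]
        · rw [if_pos rfl, hF]
        · intro Δ _ hne
          exact if_neg fun h => hne (Nat.Partition.ext h.symm)
        · intro h
          exact absurd (Finset.mem_univ _) h
        · intro k _ hne
          refine Finset.sum_eq_zero fun Δ _ => if_neg fun h => hne ?_
          rw [← p.type_sum, h, Δ.parts_sum]
        · intro h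
          rw [Finset.mem_range] at h
          omega
    rw [key]
    exact Submodule.sum_mem _ fun k _ => Submodule.sum_mem _ fun Δ _ =>
      Submodule.smul_mem _ _ (classSum_mem Δ)

theorem mul_mem_classSpan {f g : FormalSum} (hf : f ∈ classSpan) (hg : g ∈ classSpan) :
    f * g ∈ classSpan := by
  rw [mem_classSpan_iff] at *
  obtain ⟨⟨N, hN⟩, hf⟩ := hf
  obtain ⟨⟨M, hM⟩, hg⟩ := hg
  refine ⟨⟨N + M, fun p hp => ?_⟩, fun p q h => ?_⟩
  · rw [mul_apply]
    refine Finset.sum_eq_zero fun u hu => ?_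
    rw [mem_factorizations] at hu
    have h1 : p.dom.card ≤ u.1.dom.card + u.2.dom.card := by
      rw [← hu]
      exact Finset.card_union_le _ _
    by_cases h2 : N < u.1.dom.card
    · rw [hN _ h2, zero_mul]
    · rw [hM _ (by omega), mul_zero]
  · obtain ⟨c, rfl⟩ := exists_conj h
    rw [mul_apply, mul_apply]
    refine Finset.sum_nbij' (fun u => (conj c u.1, conj c u.2))
      (fun u => (conj c⁻¹ u.1, conj c⁻¹ u.2)) ?_ ?_ ?_ ?_ ?_
    · intro u hu
      rw [mem_factorizations] at hu ⊢
      rw [← conj_mul, hu]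
    · intro u hu
      rw [mem_factorizations] at hu ⊢
      have := conj_conj_inv c⁻¹ p
      rw [inv_inv] at this
      rw [← conj_mul, hu, this]
    · intro u _
      have := conj_conj_inv c⁻¹
      rw [inv_inv] at this
      simp [this]
    · intro u _
      simp [conj_conj_inv]
    · intro u _
      rw [hf _ _ (type_conj c u.1), hg _ _ (type_conj c u.2)]

theorem one_mem_classSpan : (1 : FormalSum) ∈ classSpan := by
  have : (1 : FormalSum) = classSum (n := 0) ⟨0, by simp, by simp⟩ := by
    ext p
    classical
    rw [one_apply, classSum]
    refine if_congr ⟨?_, ?_⟩ rfl rfl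
    · rintro rfl
      refine Multiset.eq_zero_of_forall_notMem fun i hi => ?_
      have h1 := Multiset.le_sum_of_mem hi
      have h2 : 0 < i := (restrict 1).partition.parts_pos hi
      rw [type_sum] at h1
      change i ≤ 0 at h1
      omega
    · intro h
      have h1 := p.type_sum
      rw [h, Multiset.sum_zero, eq_comm, Finset.card_eq_zero] at h1
      refine PartialPerm.ext h1 (Equiv.ext fun x => p.perm_eq x ?_)
      rw [h1]
      exact Finset.notMem_empty x
  rw [this]
  exact classSum_mem _

end FormalSum

/-- The Ivanov–Kerov algebra `A_∞`, spanned by the class sums of all Young diagrams, with the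
multiplication of formal sums. The class sum of the empty diagram is the unit. -/
def IvanovKerovAlgebra : Subalgebra ℂ FormalSum where
  carrier := FormalSum.classSpan
  mul_mem' := FormalSum.mul_mem_classSpan
  add_mem' := FormalSum.classSpan.add_mem
  algebraMap_mem' c := by
    rw [Algebra.algebraMap_eq_smul_one]
    exact FormalSum.classSpan.smul_mem c FormalSum.one_mem_classSpan

/-- The embedding of the vector space `A_m` in `A_∞`, which sends a Young diagram to its class
sum. -/
def toIvanovKerov (m : ℕ) : YoungAlgebra m →ₗ[ℂ] IvanovKerovAlgebra where
  toFun a := ∑ Δ : m.Partition, a Δ • ⟨FormalSum.classSum Δ, FormalSum.classSum_mem Δ⟩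
  map_add' a b := by
    simp only [YoungAlgebra.add_apply, add_smul, Finset.sum_add_distrib]
  map_smul' c a := by
    simp only [YoungAlgebra.smul_apply, Finset.smul_sum, mul_smul, RingHom.id_apply]

/-- The standard extension of degree `n` of a Young diagram of degree `m ≤ n`: add `n - m` lines of
unit length. -/
def standardExtension {m n : ℕ} (h : m ≤ n) (Δ : m.Partition) : n.Partition where
  parts := Δ.parts + Multiset.replicate (n - m) 1
  parts_pos {i} hi := by
    rcases Multiset.mem_add.1 hi with hi | hi
    · exact Δ.parts_pos hi
    · rw [Multiset.eq_of_mem_replicate hi]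
      exact one_pos
  parts_sum := by
    rw [Multiset.sum_add, Δ.parts_sum, Multiset.sum_replicate, smul_eq_mul, mul_one]
    omega

/-- The linear map `ρ_n : A_m → A_n`, `m ≤ n`, which sends a Young diagram `Δ` with standard
extension `Δ'` to `|Aut Δ'| / (|Aut Δ| |Aut (Δ' \ Δ)|) Δ'`. -/
def rho {m n : ℕ} (h : m ≤ n) : YoungAlgebra m →ₗ[ℂ] YoungAlgebra n where
  toFun a := ∑ Δ : m.Partition,
    (a Δ * ((autCard (standardExtension h Δ).parts : ℂ) /
      (autCard Δ.parts * autCard (Multiset.replicate (n - m) 1)))) •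
        YoungAlgebra.diagram (standardExtension h Δ)
  map_add' a b := by
    simp only [YoungAlgebra.add_apply, add_mul, add_smul, Finset.sum_add_distrib]
  map_smul' c a := by
    simp only [YoungAlgebra.smul_apply, Finset.smul_sum, mul_assoc, mul_smul, RingHom.id_apply]

/-- The algebra `A^as` of sequences `(a¹, a², …)` with `aⁿ ∈ A_n`, `n ≥ 1`, with entrywise
operations. -/
abbrev AsymptoticAlgebra : Type := ∀ n : ℕ+, YoungAlgebra n

/-- The sequence `a^as` of an element `a ∈ A_m`: its entries are `0` below `m` and `ρ_i(a)` for
`i ≥ m`. -/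
def asymptoticSequence {m : ℕ} (a : YoungAlgebra m) : AsymptoticAlgebra :=
  fun i => if h : m ≤ i then rho h a else 0

end

noncomputable section

/-! For each n, discard the partial permutations whose domain is not contained in {0, …, n - 1} and
forget the domain of the others, keeping only the permutation they induce. On formal sums this
assigns to `f` the function on S_n whose value at `s` is `fiberSum s f`, the sum of the coefficients
over the finite set `fiber s`. Discarding is multiplicative because a union lies in {0, …, n - 1}
exactly when both sets do, so products of formal sums become convolutions (`fiberSum_mul`). On A_∞
the coefficients are conjugation invariant, so the result is a class function, that is, an element
of A_n, where the product is convolution by `YoungAlgebra.mul_permType`.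

On a class sum [Δ] with |Δ| = m ≤ n, the value at `s` counts the (d, σ) of type Δ over `s`. It
vanishes unless `s` has the type of the standard extension of Δ, and otherwise one chooses the n - m
points outside d among the fixed points of `s` (`card_fiber_type`). This binomial coefficient is the
ratio of automorphism orders defining ρ_n, so the homomorphism extends a ↦ a^as; uniqueness holds
because diagrams span.

For injectivity, suppose that all fibre sums of `f` with n ≥ 1 vanish. Induction on |d| expresses
the coefficient at (d, σ) through those at smaller domains, but the induction cannot start: A^as has
no entry of degree 0, and the value at the unit is free. Indeed E = ∑ (-1)^|d| (d, id) has zero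
fibre sums for every n ≥ 1. Comparing `f` with f(1)·E gives f = f(1)·E, and since E has unbounded
degree while elements of A_∞ have bounded degree, f(1) = 0. -/

/-! ### Partial permutations over a given permutation of n points -/

/-- The extension of a permutation of `Fin n` to the natural numbers, by the identity. -/
def extendFin (n : ℕ) : Equiv.Perm (Fin n) →* Equiv.Perm ℕ :=
  Equiv.Perm.extendDomainHom (Fin.equivSubtype (n := n))

theorem extendFin_val {n : ℕ} (s : Equiv.Perm (Fin n)) (x : Fin n) :
    extendFin n s x = s x :=
  Equiv.Perm.extendDomain_apply_image s Fin.equivSubtype x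

theorem extendFin_of_le {n : ℕ} (s : Equiv.Perm (Fin n)) {x : ℕ} (h : n ≤ x) :
    extendFin n s x = x :=
  Equiv.Perm.extendDomain_apply_not_subtype s Fin.equivSubtype (not_lt.2 h)

theorem extendFin_injective (n : ℕ) : Function.Injective (extendFin n) :=
  Equiv.Perm.extendDomainHom_injective _

theorem exists_extendFin_eq {n : ℕ} (p : PartialPerm) (h : p.dom ⊆ Finset.range n) :
    ∃ s, extendFin n s = p.perm := by
  have hlt : ∀ x, p.perm x < n ↔ x < n := by
    intro x
    by_cases hx : x ∈ p.dom
    · exact ⟨fun _ => Finset.mem_range.1 (h hx),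
        fun _ => Finset.mem_range.1 (h ((p.perm_mem_iff x).2 hx))⟩
    · rw [p.perm_eq x hx]
  refine ⟨Fin.equivSubtype.symm.permCongr (p.perm.subtypePerm hlt), Equiv.ext fun x => ?_⟩
  by_cases hx : x < n
  · exact extendFin_val _ ⟨x, hx⟩
  · rw [extendFin_of_le _ (not_lt.1 hx), p.perm_eq x fun h' => hx (Finset.mem_range.1 (h h'))]

namespace PartialPerm

theorem conj_inv_conj (g : Equiv.Perm ℕ) (p : PartialPerm) : conj g⁻¹ (conj g p) = p := by
  simpa using conj_conj_inv g⁻¹ p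

open Classical in
/-- The partial permutations with domain in `{0, …, n - 1}` that act as `s`. -/
def fiber {n : ℕ} (s : Equiv.Perm (Fin n)) : Finset PartialPerm :=
  (finite_dom_subset (Finset.range n)).toFinset.filter fun p => p.perm = extendFin n s

theorem mem_fiber {n : ℕ} {s : Equiv.Perm (Fin n)} {p : PartialPerm} :
    p ∈ fiber s ↔ p.dom ⊆ Finset.range n ∧ p.perm = extendFin n s := by
  simp [fiber]

theorem conj_mem_fiber {n : ℕ} (g : Equiv.Perm (Fin n)) {s : Equiv.Perm (Fin n)}
    {p : PartialPerm} (hp : p ∈ fiber s) :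
    conj (extendFin n g) p ∈ fiber (g * s * g⁻¹) := by
  rw [mem_fiber] at hp ⊢
  refine ⟨fun x hx => ?_, ?_⟩
  · obtain ⟨y, hy, rfl⟩ := Finset.mem_map.1 hx
    have hy' := Finset.mem_range.1 (hp.1 hy)
    have := extendFin_val g ⟨y, hy'⟩
    change extendFin n g y ∈ _
    rw [Finset.mem_range, this]
    exact (g _).2
  · change _ * p.perm * _ = _
    rw [hp.2, map_mul, map_mul, map_inv]

theorem mul_mem_fiber {n : ℕ} {s t : Equiv.Perm (Fin n)} {p q : PartialPerm}
    (hp : p ∈ fiber s) (hq : q ∈ fiber t) : p * q ∈ fiber (s * t) := by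
  rw [mem_fiber] at *
  refine ⟨Finset.union_subset hp.1 hq.1, ?_⟩
  change p.perm * q.perm = _
  rw [hp.2, hq.2, map_mul]

/-- Domains only grow under multiplication, so a factor of an element supported in {0, …, n - 1} is
supported there too. This is what makes truncation compatible with products. -/
theorem exists_mem_fiber_of_mul_mem {n : ℕ} {s : Equiv.Perm (Fin n)} {p q : PartialPerm}
    (h : p * q ∈ fiber s) : ∃ x, p ∈ fiber x ∧ q ∈ fiber (x⁻¹ * s) := by
  rw [mem_fiber] at h
  have h1 : p.dom ∪ q.dom ⊆ Finset.range n := h.1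
  have h2 : p.perm * q.perm = extendFin n s := h.2
  obtain ⟨hp, hq⟩ := Finset.union_subset_iff.1 h1
  obtain ⟨x, hx⟩ := exists_extendFin_eq p hp
  refine ⟨x, mem_fiber.2 ⟨hp, hx.symm⟩, mem_fiber.2 ⟨hq, ?_⟩⟩
  rw [map_mul, map_inv, ← h2, hx, inv_mul_cancel_left]

theorem cycleType_restrict {n : ℕ} {s : Equiv.Perm (Fin n)} {p : PartialPerm}
    (hp : p ∈ fiber s) : p.restrict.cycleType = s.cycleType := by
  rw [mem_fiber] at hp
  let e : p.dom ≃ {x : Fin n // x.1 ∈ p.dom} :=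
    { toFun := fun x => ⟨⟨x.1, Finset.mem_range.1 (hp.1 x.2)⟩, x.2⟩
      invFun := fun x => ⟨x.1.1, x.2⟩
      left_inv := fun _ => rfl
      right_inv := fun _ => rfl }
  -- Extending the restriction by fixed points recovers `s`, and `cycleType` does not see fixed
  -- points.
  have h : p.restrict.extendDomain e = s := by
    refine Equiv.ext fun x => Fin.ext ?_
    rw [← extendFin_val s x, ← hp.2]
    by_cases hx : x.1 ∈ p.dom
    · rw [Equiv.Perm.extendDomain_apply_subtype p.restrict e hx]
      rfl
    · rw [Equiv.Perm.extendDomain_apply_not_subtype p.restrict e hx, p.perm_eq _ hx]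
  rw [← h, Equiv.Perm.cycleType_extendDomain]

theorem card_dom_le {n : ℕ} {s : Equiv.Perm (Fin n)} {p : PartialPerm} (hp : p ∈ fiber s) :
    p.dom.card ≤ n := by
  simpa using Finset.card_le_card (mem_fiber.1 hp).1

/-- The nontrivial cycles agree, and each of the n - |d| points outside the domain contributes a
line of length 1. -/
theorem permType_parts_eq {n : ℕ} {s : Equiv.Perm (Fin n)} {p : PartialPerm}
    (hp : p ∈ fiber s) :
    (permType s).parts = p.type + Multiset.replicate (n - p.dom.card) 1 := by
  have h1 := card_dom_le hp
  have h2 : p.restrict.support.card ≤ p.dom.card := by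
    simpa using Finset.card_le_univ p.restrict.support
  change s.partition.parts = p.restrict.partition.parts + _
  rw [Equiv.Perm.parts_partition, Equiv.Perm.parts_partition, add_assoc, ← Multiset.replicate_add,
    ← Equiv.Perm.sum_cycleType, ← cycleType_restrict hp, Equiv.Perm.sum_cycleType,
    Fintype.card_fin, Fintype.card_coe]
  congr 2
  omega

end PartialPerm

/-! ### Fibre cardinalities and ratios of automorphism orders -/

theorem card_filter_extendFin_eq {n : ℕ} (s : Equiv.Perm (Fin n)) :
    ((Finset.range n).filter fun x => extendFin n s x = x).card = (permType s).parts.count 1 := by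
  have h : ((Finset.range n).filter fun x => extendFin n s x = x) =
      s.supportᶜ.map Fin.valEmbedding := by
    ext x
    simp only [Finset.mem_filter, Finset.mem_range, Finset.mem_map, Finset.mem_compl,
      Equiv.Perm.mem_support, not_not, Fin.valEmbedding_apply]
    constructor
    · rintro ⟨hx, h⟩
      exact ⟨⟨x, hx⟩, Fin.ext ((extendFin_val s ⟨x, hx⟩).symm.trans h), rfl⟩
    · rintro ⟨y, hy, rfl⟩
      exact ⟨y.2, by rw [extendFin_val, hy]⟩
  have hc : s.cycleType.count 1 = 0 := Multiset.count_eq_zero.2 fun h => by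
    have := Equiv.Perm.two_le_of_mem_cycleType h
    omega
  change _ = s.partition.parts.count 1
  rw [h, Finset.card_map, Finset.card_compl, Equiv.Perm.parts_partition, Multiset.count_add, hc,
    Multiset.count_replicate_self, zero_add]

/-- The number of partial permutations of given type that extend to a given permutation. -/
theorem card_fiber_type {m n : ℕ} (h : m ≤ n) (Δ : m.Partition) {s : Equiv.Perm (Fin n)}
    (hs : permType s = standardExtension h Δ)
    [DecidablePred fun p : PartialPerm => p.type = Δ.parts] :
    ((PartialPerm.fiber s).filter fun p => p.type = Δ.parts).card =
      ((permType s).parts.count 1).choose (n - m) := by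
  rw [← card_filter_extendFin_eq, ← Finset.card_powersetCard]
  -- Over a fixed `s` only the domain is free; its complement may be any set of n - m fixed points
  -- of `s`.
  refine Finset.card_bij (fun p _ => Finset.range n \ p.dom) ?_ ?_ ?_
  · intro p hp
    obtain ⟨hp, ht⟩ := Finset.mem_filter.1 hp
    obtain ⟨h1, h2⟩ := PartialPerm.mem_fiber.1 hp
    have hm : p.dom.card = m := by rw [← p.type_sum, ht, Δ.parts_sum]
    rw [Finset.mem_powersetCard, Finset.card_sdiff_of_subset h1, Finset.card_range, hm]
    refine ⟨fun x hx => ?_, rfl⟩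
    obtain ⟨hx, hxd⟩ := Finset.mem_sdiff.1 hx
    rw [Finset.mem_filter, ← h2]
    exact ⟨hx, p.perm_eq x hxd⟩
  · intro p hp q hq hpq
    obtain ⟨hp1, hp2⟩ := PartialPerm.mem_fiber.1 (Finset.mem_filter.1 hp).1
    obtain ⟨hq1, hq2⟩ := PartialPerm.mem_fiber.1 (Finset.mem_filter.1 hq).1
    refine PartialPerm.ext ?_ (hp2.trans hq2.symm)
    rw [← Finset.sdiff_sdiff_eq_self hp1, hpq, Finset.sdiff_sdiff_eq_self hq1]
  · intro t ht
    obtain ⟨ht, hc⟩ := Finset.mem_powersetCard.1 ht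
    have htn : t ⊆ Finset.range n := ht.trans (Finset.filter_subset _ _)
    let p : PartialPerm := ⟨Finset.range n \ t, extendFin n s, fun x hx => by
      by_cases hxn : x ∈ Finset.range n
      · have : x ∈ t := by
          by_contra hxt
          exact hx (Finset.mem_sdiff.2 ⟨hxn, hxt⟩)
        exact (Finset.mem_filter.1 (ht this)).2
      · exact extendFin_of_le s (by simpa using hxn)⟩
    have hp : p ∈ PartialPerm.fiber s := PartialPerm.mem_fiber.2 ⟨Finset.sdiff_subset, rfl⟩
    have hcard : n - p.dom.card = n - m := by
      change n - (Finset.range n \ t).card = _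
      rw [Finset.card_sdiff_of_subset htn, hc, Finset.card_range]
      omega
    refine ⟨p, Finset.mem_filter.2 ⟨hp, ?_⟩, Finset.sdiff_sdiff_eq_self htn⟩
    -- Both descriptions of the type of `s` add n - m lines of length 1; cancelling them identifies
    -- the type of `p` with Δ.
    have h1 := PartialPerm.permType_parts_eq hp
    rw [hs, hcard] at h1
    exact (add_right_cancel h1).symm

/-- Only the factor at j = 1 changes, from `(M.count 1)!` to `(M.count 1 + k)!`. -/
theorem autCard_add_replicate_one (M : Multiset ℕ) (k : ℕ) :
    autCard (M + Multiset.replicate k 1) * (M.count 1)! = autCard M * (M.count 1 + k)! := by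
  -- Splitting off j = 1 over a larger index set covers multisets without a part 1 and lets both
  -- sides share the same `T`.
  have key : ∀ N : Multiset ℕ, ∀ T : Finset ℕ, N.toFinset ⊆ insert 1 T → 1 ∉ T →
      autCard N = (N.count 1)! * ∏ j ∈ T, (N.count j)! * j ^ N.count j := by
    intro N T hT h1
    rw [autCard, Finset.prod_subset hT, Finset.prod_insert h1, one_pow, mul_one]
    intro j _ hj
    rw [Multiset.mem_toFinset] at hj
    simp [Multiset.count_eq_zero.2 hj]
  have hT : M.toFinset ⊆ insert 1 (M.toFinset.erase 1) := by
    intro j hj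
    by_cases h : j = 1 <;> simp_all
  have hT' : (M + Multiset.replicate k 1).toFinset ⊆ insert 1 (M.toFinset.erase 1) := by
    intro j hj
    rw [Multiset.mem_toFinset, Multiset.mem_add] at hj
    rcases hj with hj | hj
    · exact hT (Multiset.mem_toFinset.2 hj)
    · simp [Multiset.eq_of_mem_replicate hj]
  rw [key _ _ hT (Finset.notMem_erase _ _), key _ _ hT' (Finset.notMem_erase _ _),
    Multiset.count_add, Multiset.count_replicate_self]
  have : ∏ j ∈ M.toFinset.erase 1, ((M + Multiset.replicate k 1).count j)! *
      j ^ (M + Multiset.replicate k 1).count j =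
      ∏ j ∈ M.toFinset.erase 1, (M.count j)! * j ^ M.count j := by
    refine Finset.prod_congr rfl fun j hj => ?_
    have : (M + Multiset.replicate k 1).count j = M.count j := by
      rw [Multiset.count_add, Multiset.count_replicate, if_neg (Finset.ne_of_mem_erase hj).symm,
        add_zero]
    rw [this]
  rw [this]
  ring

theorem autCard_replicate_one (k : ℕ) : autCard (Multiset.replicate k 1) = k ! := by
  simpa [autCard] using autCard_add_replicate_one 0 k

/-- With c parts equal to 1 in Δ, the ratio is (c + n - m)! / (c! (n - m)!). This matches the
coefficient of ρ_n with the count in `card_fiber_type`. -/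
theorem autCard_standardExtension_div {m n : ℕ} (h : m ≤ n) (Δ : m.Partition) :
    (autCard (standardExtension h Δ).parts : ℂ) /
      (autCard Δ.parts * autCard (Multiset.replicate (n - m) 1)) =
      (((standardExtension h Δ).parts.count 1).choose (n - m) : ℕ) := by
  have h1 : autCard (standardExtension h Δ).parts * (Δ.parts.count 1)! =
      autCard Δ.parts * (Δ.parts.count 1 + (n - m))! := autCard_add_replicate_one _ _
  have h2 : (standardExtension h Δ).parts.count 1 = Δ.parts.count 1 + (n - m) := by
    change (Δ.parts + Multiset.replicate (n - m) 1).count 1 = _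
    rw [Multiset.count_add, Multiset.count_replicate_self]
  have h3 := Nat.add_choose_mul_factorial_mul_factorial (Δ.parts.count 1) (n - m)
  have h4 := YoungAlgebra.autCard_ne_zero Δ
  have h5 : ((Δ.parts.count 1)! : ℂ) ≠ 0 := Nat.cast_ne_zero.2 (Nat.factorial_ne_zero _)
  have h6 : ((n - m)! : ℂ) ≠ 0 := Nat.cast_ne_zero.2 (Nat.factorial_ne_zero _)
  rw [autCard_replicate_one, h2, div_eq_iff (mul_ne_zero h4 h6)]
  refine mul_right_cancel₀ h5 ?_
  exact_mod_cast (h1.trans (by rw [← h3]; ring))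

/-! ### Fibre sums turn products into convolutions -/

namespace FormalSum

open PartialPerm

/-- The sum of the coefficients of the partial permutations in the fibre over `s`. -/
def fiberSum {n : ℕ} (s : Equiv.Perm (Fin n)) : FormalSum →ₗ[ℂ] ℂ where
  toFun f := ∑ p ∈ fiber s, f p
  map_add' _ _ := Finset.sum_add_distrib
  map_smul' _ _ := (Finset.mul_sum _ _ _).symm

theorem fiberSum_apply {n : ℕ} (s : Equiv.Perm (Fin n)) (f : FormalSum) :
    fiberSum s f = ∑ p ∈ fiber s, f p := rfl

theorem fiberSum_one {n : ℕ} (s : Equiv.Perm (Fin n)) :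
    fiberSum s 1 = if s = 1 then 1 else 0 := by
  classical
  have : (1 : PartialPerm) ∈ fiber s ↔ s = 1 := by
    rw [mem_fiber]
    change ((∅ : Finset ℕ) ⊆ _ ∧ 1 = _) ↔ _
    rw [eq_comm, map_eq_one_iff _ (extendFin_injective n)]
    simp
  simp [fiberSum_apply, one_apply, this]

/-- Both sides sum f(u) g(v) over the pairs supported in {0, …, n - 1} whose permutations multiply
to `s`, grouped by the product uv on the left and by the permutation x of u on the right. -/
theorem fiberSum_mul {n : ℕ} (s : Equiv.Perm (Fin n)) (f g : FormalSum) :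
    fiberSum s (f * g) = ∑ x, fiberSum x f * fiberSum (x⁻¹ * s) g := by
  have h : ∀ x, fiberSum x f * fiberSum (x⁻¹ * s) g =
      ∑ u ∈ fiber x ×ˢ fiber (x⁻¹ * s), f u.1 * g u.2 := fun x =>
    (Finset.sum_mul_sum _ _ _ _).trans (Finset.sum_product' _ _ _).symm
  rw [Finset.sum_congr rfl fun x _ => h x, fiberSum_apply, Finset.sum_sigma']
  refine Eq.trans ?_ (Finset.sum_sigma' (fiber s) factorizations
    fun _ u => f u.1 * g u.2).symm |>.symm
  refine Finset.sum_bij (fun w _ => ⟨w.2.1 * w.2.2, w.2⟩) ?_ ?_ ?_ ?_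
  · rintro ⟨x, u, v⟩ hw
    simp only [Finset.mem_sigma, Finset.mem_product, Finset.mem_univ, true_and,
      mem_factorizations, and_true] at hw ⊢
    simpa using mul_mem_fiber hw.1 hw.2
  · rintro ⟨x, u, v⟩ hw ⟨x', u', v'⟩ hw' heq
    simp only [Finset.mem_sigma, Finset.mem_product, Finset.mem_univ, true_and] at hw hw'
    have h : (u, v) = (u', v') := by
      have := (Sigma.mk.inj_iff.1 heq).2
      exact eq_of_heq this
    obtain ⟨rfl, rfl⟩ := Prod.mk_inj.1 h
    -- The index x is not part of the image, but it is recovered from u.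
    have := extendFin_injective n
      ((mem_fiber.1 hw.1).2.symm.trans (mem_fiber.1 hw'.1).2)
    rw [this]
  · rintro ⟨p, u, v⟩ hw
    simp only [Finset.mem_sigma, mem_factorizations] at hw
    obtain ⟨hp, rfl⟩ := hw
    obtain ⟨x, hx⟩ := exists_mem_fiber_of_mul_mem hp
    exact ⟨⟨x, u, v⟩, by simpa using hx, rfl⟩
  · intro w _
    rfl

theorem apply_conj {f : FormalSum} (hf : f ∈ classSpan) (g : Equiv.Perm ℕ) (p : PartialPerm) :
    f (conj g p) = f p :=
  ((mem_classSpan_iff f).1 hf).2 _ _ (type_conj g p)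

/-- Conjugation by the extension of `g` is a bijection between the two fibres and preserves the
coefficients of `f`. -/
theorem fiberSum_conj {n : ℕ} {f : FormalSum} (hf : f ∈ classSpan)
    (g s : Equiv.Perm (Fin n)) : fiberSum (g * s * g⁻¹) f = fiberSum s f := by
  symm
  refine Finset.sum_nbij' (conj (extendFin n g)) (conj (extendFin n g)⁻¹)
    (fun p hp => conj_mem_fiber g hp) (fun p hp => ?_) (fun p _ => conj_inv_conj _ p)
    (fun p _ => conj_conj_inv _ p) (fun p _ => (apply_conj hf _ p).symm)
  have := conj_mem_fiber g⁻¹ hp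
  rw [map_inv] at this
  convert this using 2
  group

theorem fiberSum_congr {n : ℕ} {f : FormalSum} (hf : f ∈ classSpan) {s t : Equiv.Perm (Fin n)}
    (h : permType s = permType t) : fiberSum s f = fiberSum t f := by
  obtain ⟨g, rfl⟩ := isConj_iff.1 ((permType_eq_iff s t).1 h)
  exact (fiberSum_conj hf g s).symm


end FormalSum

/-! ### Fibre sums of Young diagrams are the entries of `a^as` -/

theorem YoungAlgebra.sum_apply {ι : Type*} {n : ℕ} (t : Finset ι) (a : ι → YoungAlgebra n)
    (q : n.Partition) : (∑ i ∈ t, a i) q = ∑ i ∈ t, a i q :=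
  Finset.sum_apply (M := fun _ => ℂ) q t a

theorem rho_apply {m n : ℕ} (h : m ≤ n) (a : YoungAlgebra m) (q : n.Partition) :
    rho h a q = ∑ Δ : m.Partition, a Δ *
      if q = standardExtension h Δ then ((q.parts.count 1).choose (n - m) : ℂ) else 0 := by
  refine Eq.trans (b := (∑ Δ : m.Partition, _ : YoungAlgebra n) q) rfl
    ((YoungAlgebra.sum_apply _ _ _).trans (Finset.sum_congr rfl fun Δ _ => ?_))
  rw [autCard_standardExtension_div, YoungAlgebra.smul_apply, YoungAlgebra.diagram]
  split_ifs with hq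
  · rw [hq, mul_one]
  · rw [mul_zero, mul_zero]

theorem coe_toIvanovKerov (m : ℕ) (a : YoungAlgebra m) :
    (toIvanovKerov m a : FormalSum) = ∑ Δ : m.Partition, a Δ • FormalSum.classSum Δ := by
  change ((∑ Δ : m.Partition, a Δ •
    (⟨FormalSum.classSum Δ, FormalSum.classSum_mem Δ⟩ : IvanovKerovAlgebra) :
      IvanovKerovAlgebra) : FormalSum) = _
  rw [AddSubmonoidClass.coe_finsetSum]
  rfl

theorem exists_map_eq_of_card_eq {s t : Finset ℕ} (h : s.card = t.card) :
    ∃ g : Equiv.Perm ℕ, s.map g.toEmbedding = t := by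
  -- Identities on sets of equal size have the same type, so `exists_conj` supplies the permutation
  -- of ℕ.
  let p : PartialPerm := ⟨s, 1, fun _ _ => rfl⟩
  let q : PartialPerm := ⟨t, 1, fun _ _ => rfl⟩
  obtain ⟨g, hg⟩ := PartialPerm.exists_conj (p := p) (q := q)
    (PartialPerm.type_eq_of_equiv (Finset.equivOfCardEq h)
      (Equiv.ext fun x => (Finset.equivOfCardEq h).apply_symm_apply x))
  exact ⟨g, congrArg PartialPerm.dom hg⟩

namespace FormalSum

open PartialPerm

theorem fiberSum_classSum_of_le {m n : ℕ} (h : m ≤ n) (Δ : m.Partition)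
    (s : Equiv.Perm (Fin n)) : fiberSum s (classSum Δ) =
      if permType s = standardExtension h Δ then
        (((permType s).parts.count 1).choose (n - m) : ℂ) else 0 := by
  classical
  rw [fiberSum_apply]
  split_ifs with hs
  · rw [← card_fiber_type h Δ hs, ← Finset.sum_boole]
    rfl
  · refine Finset.sum_eq_zero fun p hp => if_neg fun ht => hs (Nat.Partition.ext ?_)
    rw [permType_parts_eq hp, ht, ← p.type_sum, ht, Δ.parts_sum]
    rfl

theorem fiberSum_classSum_of_lt {m n : ℕ} (h : n < m) (Δ : m.Partition)
    (s : Equiv.Perm (Fin n)) : fiberSum s (classSum Δ) = 0 := by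
  rw [fiberSum_apply]
  refine Finset.sum_eq_zero fun p hp => if_neg fun ht => ?_
  have := card_dom_le hp
  rw [← p.type_sum, ht, Δ.parts_sum] at this
  omega

theorem fiberSum_toIvanovKerov {m : ℕ} (a : YoungAlgebra m) {n : ℕ+} (s : Equiv.Perm (Fin n)) :
    fiberSum s (toIvanovKerov m a : FormalSum) = asymptoticSequence a n (permType s) := by
  rw [coe_toIvanovKerov, map_sum, asymptoticSequence]
  split_ifs with h
  · rw [rho_apply]
    refine Finset.sum_congr rfl fun Δ _ => ?_
    rw [map_smul, smul_eq_mul, fiberSum_classSum_of_le h]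
  · refine Finset.sum_eq_zero fun Δ _ => ?_
    rw [map_smul, fiberSum_classSum_of_lt (not_le.1 h), smul_zero]

/-! ### The homomorphisms from A_∞ to A_n -/

/-- The class function on `S_n` whose values are the sums of coefficients over the fibres. -/
def toYoungAlgebra (n : ℕ) : IvanovKerovAlgebra →ₗ[ℂ] YoungAlgebra n where
  toFun f := fun q => fiberSum (Function.surjInv (permType_surjective n) q) f
  map_add' f g := YoungAlgebra.ext fun _ => map_add (fiberSum _) (f : FormalSum) g
  map_smul' c f := YoungAlgebra.ext fun _ => map_smul (fiberSum _) c (f : FormalSum)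

/-- The representative chosen by `Function.surjInv` is immaterial, since coefficients in A_∞ are
conjugation invariant. -/
theorem toYoungAlgebra_permType {n : ℕ} (f : IvanovKerovAlgebra) (s : Equiv.Perm (Fin n)) :
    toYoungAlgebra n f (permType s) = fiberSum s f :=
  fiberSum_congr f.2 (Function.surjInv_eq (permType_surjective n) _)

theorem toYoungAlgebra_one (n : ℕ) : toYoungAlgebra n 1 = 1 :=
  YoungAlgebra.ext_permType fun s => by
    rw [toYoungAlgebra_permType, YoungAlgebra.one_permType]
    exact fiberSum_one s

theorem toYoungAlgebra_mul (n : ℕ) (f g : IvanovKerovAlgebra) :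
    toYoungAlgebra n (f * g) = toYoungAlgebra n f * toYoungAlgebra n g :=
  YoungAlgebra.ext_permType fun s => by
    rw [YoungAlgebra.mul_permType]
    simp only [toYoungAlgebra_permType]
    exact fiberSum_mul s f g

/-! ### Injectivity -/

/-- A class function on `D_∞` with zero fibre sums that vanishes at the unit is zero. -/
theorem eq_zero_of_fiberSum_eq_zero {f : FormalSum} (hf : ∀ g p, f (conj g p) = f p)
    (h1 : f 1 = 0) (h : ∀ (n : ℕ+) (s : Equiv.Perm (Fin n)), fiberSum s f = 0) (p : PartialPerm) :
    f p = 0 := by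
  induction hn : p.dom.card using Nat.strong_induction_on generalizing p with
  | _ n ih =>
    rcases Nat.eq_zero_or_pos n with rfl | hpos
    · rw [Finset.card_eq_zero] at hn
      have : p = 1 := PartialPerm.ext hn (Equiv.ext fun x => p.perm_eq x (by simp [hn]))
      rw [this, h1]
    -- Once the domain is moved onto all of {0, …, n - 1}, every other element of its fibre has a
    -- strictly smaller domain, so the vanishing fibre sum reduces to the single coefficient wanted.
    · obtain ⟨g, hg⟩ := exists_map_eq_of_card_eq (s := p.dom) (t := Finset.range n)
        (by rw [hn, Finset.card_range])
      have hdom : (conj g p).dom = Finset.range n := hg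
      obtain ⟨s, hs⟩ := exists_extendFin_eq (conj g p) hdom.le
      have hsum := h ⟨n, hpos⟩ s
      have hmem : conj g p ∈ fiber s := mem_fiber.2 ⟨hdom.le, hs.symm⟩
      rw [← hf g, ← hsum]
      refine (Finset.sum_eq_single_of_mem _ hmem ?_).symm
      intro q hq hne
      refine ih _ ?_ q rfl
      obtain ⟨hq1, hq2⟩ := mem_fiber.1 hq
      have : q.dom ⊂ Finset.range n := hq1.ssubset_of_ne fun heq =>
        hne (PartialPerm.ext (heq.trans hdom.symm) (hq2.trans hs))
      simpa using Finset.card_lt_card this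

open Classical in
/-- The alternating sum of the identities of all finite sets of natural numbers. -/
def alternatingSum : FormalSum := fun p => if p.perm = 1 then (-1) ^ p.dom.card else 0

/-- The fibre over the identity is the power set of {0, …, n - 1}, whose alternating sum vanishes
because n > 0; over any other `s` all coefficients are zero. -/
theorem fiberSum_alternatingSum (n : ℕ+) (s : Equiv.Perm (Fin n)) :
    fiberSum s alternatingSum = 0 := by
  rw [fiberSum_apply]
  by_cases hs : s = 1
  · subst hs
    have h := Finset.sum_powerset_neg_one_pow_card_of_nonempty
      (x := Finset.range n) (Finset.nonempty_range_iff.2 n.ne_zero)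
    have h' : ∑ d ∈ (Finset.range n).powerset, (-1 : ℂ) ^ d.card = 0 := by exact_mod_cast h
    rw [← h']
    refine Finset.sum_bij' (fun p _ => p.dom) (fun d _ => ⟨d, 1, fun _ _ => rfl⟩)
      ?_ ?_ ?_ ?_ ?_
    · intro p hp
      exact Finset.mem_powerset.2 (mem_fiber.1 hp).1
    · intro d hd
      exact mem_fiber.2 ⟨Finset.mem_powerset.1 hd, (map_one _).symm⟩
    · intro p hp
      refine PartialPerm.ext rfl ?_
      rw [(mem_fiber.1 hp).2, map_one]
    · intro d _
      rfl
    · intro p hp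
      exact if_pos ((mem_fiber.1 hp).2.trans (map_one _))
  · refine Finset.sum_eq_zero fun p hp => if_neg fun h => hs (extendFin_injective n ?_)
    rw [← (mem_fiber.1 hp).2, h, map_one]

theorem alternatingSum_conj (g : Equiv.Perm ℕ) (p : PartialPerm) :
    alternatingSum (conj g p) = alternatingSum p := by
  have h1 : (conj g p).perm = 1 ↔ p.perm = 1 := conj_eq_one_iff
  have h2 : (conj g p).dom.card = p.dom.card := Finset.card_map _
  classical
  rw [alternatingSum, alternatingSum, h2]
  exact if_congr h1 rfl rfl

/-- Among conjugation invariant formal sums, the vanishing of these fibre sums leaves exactly the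
multiples of `alternatingSum`; bounded degree excludes the nonzero ones. -/
theorem eq_zero_of_mem_classSpan {f : FormalSum} (hf : f ∈ classSpan)
    (h : ∀ (n : ℕ+) (s : Equiv.Perm (Fin n)), fiberSum s f = 0) : f = 0 := by
  have key : ∀ p, f p = f 1 * alternatingSum p := by
    intro p
    have := eq_zero_of_fiberSum_eq_zero (f := f - f 1 • alternatingSum)
      (fun g q => ?_) ?_ (fun n s => ?_) p
    · exact sub_eq_zero.1 this
    · change f _ - f 1 * alternatingSum _ = f _ - f 1 * alternatingSum _
      rw [apply_conj hf, alternatingSum_conj]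
    · have h1 : alternatingSum 1 = 1 := if_pos rfl
      change f 1 - f 1 * alternatingSum 1 = 0
      rw [h1, mul_one, sub_self]
    · rw [map_sub, map_smul, h, fiberSum_alternatingSum, smul_zero, sub_zero]
  obtain ⟨N, hN⟩ := ((mem_classSpan_iff f).1 hf).1
  -- An identity just beyond the degree bound: `f` vanishes there, while `alternatingSum` is ±1.
  let p : PartialPerm := ⟨Finset.range (N + 1), 1, fun _ _ => rfl⟩
  have hp : f 1 * (-1) ^ p.dom.card = 0 := by
    have h0 : alternatingSum p = (-1) ^ p.dom.card := if_pos rfl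
    rw [← h0, ← key]
    exact hN p (by simp [p])
  have h1 : f 1 = 0 := by simpa using hp
  ext p
  rw [key, h1, zero_mul]
  rfl

end FormalSum

/-! ### Assembling the homomorphism; uniqueness -/

/-- The homomorphism `ρ_↑` from the Ivanov–Kerov algebra to the algebra of sequences. -/
def asymptoticHom : IvanovKerovAlgebra →ₐ[ℂ] AsymptoticAlgebra :=
  AlgHom.ofLinearMap (LinearMap.pi fun n : ℕ+ => FormalSum.toYoungAlgebra n)
    (funext fun n => FormalSum.toYoungAlgebra_one n)
    (fun f g => funext fun n => FormalSum.toYoungAlgebra_mul n f g)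

theorem asymptoticHom_apply (f : IvanovKerovAlgebra) (n : ℕ+) :
    asymptoticHom f n = FormalSum.toYoungAlgebra n f := rfl

theorem asymptoticHom_toIvanovKerov (m : ℕ) (a : YoungAlgebra m) :
    asymptoticHom (toIvanovKerov m a) = asymptoticSequence a :=
  funext fun n => YoungAlgebra.ext_permType fun s => by
    rw [asymptoticHom_apply, FormalSum.toYoungAlgebra_permType,
      FormalSum.fiberSum_toIvanovKerov]

theorem asymptoticHom_injective : Function.Injective asymptoticHom := by
  rw [injective_iff_map_eq_zero]
  intro f hf
  refine Subtype.ext (FormalSum.eq_zero_of_mem_classSpan f.2 fun n s => ?_)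
  rw [← FormalSum.toYoungAlgebra_permType, ← asymptoticHom_apply, hf]
  rfl

theorem toIvanovKerov_diagram {m : ℕ} (Δ : m.Partition) :
    (toIvanovKerov m (YoungAlgebra.diagram Δ) : FormalSum) = FormalSum.classSum Δ := by
  rw [coe_toIvanovKerov, Finset.sum_eq_single_of_mem Δ (Finset.mem_univ _)]
  · simp [YoungAlgebra.diagram]
  · intro Δ' _ h
    simp [YoungAlgebra.diagram, h]

/-- Linear maps on the Ivanov–Kerov algebra that agree on Young diagrams are equal. -/
theorem linearMap_ext_of_diagrams {M : Type*} [AddCommMonoid M] [Module ℂ M]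
    {u v : IvanovKerovAlgebra →ₗ[ℂ] M}
    (h : ∀ (m : ℕ) (a : YoungAlgebra m), u (toIvanovKerov m a) = v (toIvanovKerov m a)) :
    u = v := by
  refine LinearMap.ext fun f => ?_
  obtain ⟨f, hf⟩ := f
  induction hf using Submodule.span_induction with
  | mem x hx =>
    obtain ⟨⟨m, Δ⟩, rfl⟩ := hx
    have : (⟨FormalSum.classSum Δ, FormalSum.classSum_mem Δ⟩ : IvanovKerovAlgebra) =
        toIvanovKerov m (YoungAlgebra.diagram Δ) := Subtype.ext (toIvanovKerov_diagram Δ).symm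
    exact (congrArg u this).trans ((h _ _).trans (congrArg v this).symm)
  | zero => exact (map_zero u).trans (map_zero v).symm
  | add x y hx hy h1 h2 =>
    exact (map_add u ⟨x, hx⟩ ⟨y, hy⟩).trans
      ((congrArg₂ _ h1 h2).trans (map_add v ⟨x, hx⟩ ⟨y, hy⟩).symm)
  | smul c x hx h1 =>
    exact (map_smul u c ⟨x, hx⟩).trans ((congrArg _ h1).trans (map_smul v c ⟨x, hx⟩).symm)

end

/-- The correspondence `a ↦ a^as`, `a ∈ A_m`, extends (uniquely) from the Young diagrams to an
injective algebra homomorphism `ρ_↑` from the Ivanov–Kerov algebra to the algebra `A^as`. -/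
theorem theorem3p1 :
    ∃ ρ : IvanovKerovAlgebra →ₐ[ℂ] AsymptoticAlgebra,
      (∀ (m : ℕ) (a : YoungAlgebra m), ρ (toIvanovKerov m a) = asymptoticSequence a) ∧
      Function.Injective ρ ∧
      ∀ ρ' : IvanovKerovAlgebra →ₗ[ℂ] AsymptoticAlgebra,
        (∀ (m : ℕ) (a : YoungAlgebra m), ρ' (toIvanovKerov m a) = asymptoticSequence a) →
          ρ' = ρ.toLinearMap :=
  ⟨asymptoticHom, asymptoticHom_toIvanovKerov, asymptoticHom_injective, fun _ h =>
    linearMap_ext_of_diagrams fun m a =>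
      (h m a).trans (asymptoticHom_toIvanovKerov m a).symm⟩
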